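/- Let $\Omega=\{0,1\}^{\infty}$ and, for $\omega\in\Omega$ and $t\ge 0$, let $\omega^{t}\subseteq\Omega$ be the cylinder of all paths that agree with $\omega$ in the first $t$ coordinates. Let $\Sigma$ be any $\sigma$-algebra on $\Omega$ containing all cylinders, let $\mathbb{P}$ be the set of finitely additive probabilities on $(\Omega,\Sigma)$, and let $\mathcal{F}\subseteq\Sigma$ be the algebra generated by the cylinders. For $P\in\mathbb{P}$ write $P_{\mathcal F}$ for the restriction of $P$ to $\mathcal F$, let $E(P_{\mathcal F},\mathcal F,\Sigma)$ be the convex set of all $Q\in\mathbb{P}$ with $Q(A)=P(A)$ for every $A\in\mathcal F$, and write $P(E\mid\omega^t)=P(E\cap\omega^t)/P(\omega^t)$ when $P(\omega^t)>0$, with the convention $P(E\mid\omega^t)=0$ when $P(\omega^t)=0$ (this convention does not affect the theorem). For $P,Q\in\mathbb{P}$: - $Q\ll P$ means that for every sequence $(E_n)$ in $\Sigma$, if $P(E_n)\to 0$ then $Q(E_n)\to 0$; - $P$ merges with $Q$ if for every $\varepsilon>0$ $$\lim_{t\to\infty}Q\Bigl(\Bigl\{\omega:\ \sup_{E\in\Sigma}\bigl|P(E\mid\omega^{t})-Q(E\mid\omega^{t})\bigr|>\varepsilon\Bigr\}\Bigr)=0;$$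 - $P$ satisfies the Blackwell--Dubins property if $P$ merges with every $Q\in\mathbb{P}$ such that $Q\ll P$. Then for every $P\in\mathbb{P}$ the following are equivalent: 1. $P$ is an extreme point of $E(P_{\mathcal F},\mathcal F,\Sigma)$. 2. $P$ satisfies the Blackwell--Dubins property. 3. For all $Q,R\in\mathbb{P}$, if $P=\alpha Q+(1-\alpha)R$ for some $\alpha\in(0,1)$, then $P$ merges with $Q$ and with $R$. -/

import Mathlib

noncomputable section

namespace Merging

open MeasureTheory Filter Topology

/-- The set of paths `{0,1}^∞`. -/
abbrev Path : Type := ℕ → Bool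

/-- The cylinder `ω^t` of all paths that agree with `ω` in the first `t` periods. -/
abbrev cyl (ω : Path) (t : ℕ) : Set Path := PiNat.cylinder (E := fun _ : ℕ => Bool) ω t

/-- The σ-algebra `S` contains all cylinders. -/
def ContainsCylinders (S : MeasurableSpace Path) : Prop :=
  ∀ (ω : Path) (t : ℕ), MeasurableSet[S] (cyl ω t)

/-- The algebra of subsets of `{0,1}^∞` generated by the cylinders. -/
def cylAlgebra : Set (Set Path) :=
  generateSetAlgebra {C | ∃ (ω : Path) (t : ℕ), C = cyl ω t}

/-- The events of the σ-algebra `S`, as a family of sets. -/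
def events (S : MeasurableSpace Path) : Set (Set Path) := {A | MeasurableSet[S] A}

/-- The finitely additive probabilities on the algebra of sets `𝒜`, as a subset of the real vector
space of functions `𝒜 → ℝ`. -/
def finAddProb (𝒜 : Set (Set Path)) : Set (𝒜 → ℝ) :=
  {P | (∀ A, 0 ≤ P A) ∧
    (∀ A : 𝒜, (A : Set Path) = Set.univ → P A = 1) ∧
    ∀ A B C : 𝒜, Disjoint (A : Set Path) B → (C : Set Path) = (A : Set Path) ∪ B → P C = P A + P B}

/-- The restriction of a set function from `𝒜₂` to a smaller family `𝒜₁`. -/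
def restrict {𝒜₁ 𝒜₂ : Set (Set Path)} (h : 𝒜₁ ⊆ 𝒜₂) (P : 𝒜₂ → ℝ) : 𝒜₁ → ℝ :=
  fun A => P ⟨A, h A.2⟩

/-- The set of finitely additive probabilities on `𝒜₂` that extend `P` from `𝒜₁` to `𝒜₂`. -/
def extensions {𝒜₁ 𝒜₂ : Set (Set Path)} (h : 𝒜₁ ⊆ 𝒜₂) (P : 𝒜₁ → ℝ) : Set (𝒜₂ → ℝ) :=
  {Q | Q ∈ finAddProb 𝒜₂ ∧ restrict h Q = P}

theorem cylAlgebra_subset_events {S : MeasurableSpace Path} (hS : ContainsCylinders S) :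
    cylAlgebra ⊆ events S := by
  intro A hA
  induction hA with
  | base s hs => obtain ⟨ω, t, rfl⟩ := hs; exact hS ω t
  | empty => exact @MeasurableSet.empty _ S
  | compl s _ ih => exact MeasurableSet.compl ih
  | union s t _ _ ihs iht => exact MeasurableSet.union ihs iht

/-- The conditional probability `P(E | ω^t) = P(E ∩ ω^t) / P(ω^t)`. (It is meant for
`P(ω^t) > 0`; otherwise the division returns `0`.) -/
def condProb {S : MeasurableSpace Path} (hS : ContainsCylinders S) (P : events S → ℝ)
    (ω : Path) (t : ℕ) (E : events S) : ℝ :=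
  P ⟨E ∩ cyl ω t, MeasurableSet.inter E.2 (hS ω t)⟩ / P ⟨cyl ω t, hS ω t⟩

/-- The distance `sup_E |P(E | ω^t) - Q(E | ω^t)|` between the forecasts of `P` and `Q`, where
`E` ranges over all events. -/
def forecastDist {S : MeasurableSpace Path} (hS : ContainsCylinders S) (P Q : events S → ℝ)
    (ω : Path) (t : ℕ) : ℝ :=
  ⨆ E : events S, |condProb hS P ω t E - condProb hS Q ω t E|

/-- The set of paths along which the forecasts at time `t` differ by more than `ε` is an event. -/
theorem forecastDist_event {S : MeasurableSpace Path} (hS : ContainsCylinders S)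
    (P Q : events S → ℝ) (t : ℕ) (ε : ℝ) :
    {ω | forecastDist hS P Q ω t > ε} ∈ events S := by
  have hdep : ∀ ω ω' : Path, cyl ω t = cyl ω' t →
      forecastDist hS P Q ω t = forecastDist hS P Q ω' t := by
    intro ω ω' h
    simp only [forecastDist, condProb, h]
  have hfin : (Set.range fun ω : Path => cyl ω t).Finite := by
    refine Set.Finite.subset (Set.finite_range
      (fun x : Fin t → Bool => {y : Path | ∀ i : Fin t, y i = x i})) ?_
    rintro _ ⟨ω, rfl⟩
    refine ⟨fun i => ω i, ?_⟩
    ext y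
    exact ⟨fun h i hi => h ⟨i, hi⟩, fun h i => h i i.2⟩
  have heq : {ω | forecastDist hS P Q ω t > ε} =
      ⋃₀ ((fun ω : Path => cyl ω t) '' {ω | forecastDist hS P Q ω t > ε}) := by
    ext y
    constructor
    · intro hy
      exact ⟨cyl y t, ⟨y, hy, rfl⟩, PiNat.self_mem_cylinder y t⟩
    · rintro ⟨_, ⟨ω, hω, rfl⟩, hy⟩
      have h : cyl y t = cyl ω t := PiNat.mem_cylinder_iff_eq.1 hy
      exact lt_of_lt_of_eq hω (hdep y ω h).symm
  rw [heq]
  refine MeasurableSet.sUnion (hfin.subset (Set.image_subset_range _ _)).countable ?_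
  rintro _ ⟨ω, _, rfl⟩
  exact hS ω t

/-- `P` merges with `Q`: under `Q`, the distance between the forecasts of `P` and `Q` goes to `0`
in probability. -/
def Merges {S : MeasurableSpace Path} (hS : ContainsCylinders S) (P Q : events S → ℝ) : Prop :=
  ∀ ε : ℝ, 0 < ε →
    Tendsto (fun t : ℕ => Q ⟨{ω | forecastDist hS P Q ω t > ε}, forecastDist_event hS P Q t ε⟩)
      atTop (𝓝 0)

/-- `Q ≪ P`: for every sequence of events, `P(E_n) → 0` implies `Q(E_n) → 0`. -/
def AbsCont {S : MeasurableSpace Path} (Q P : events S → ℝ) : Prop :=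
  ∀ E : ℕ → events S, Tendsto (fun n => P (E n)) atTop (𝓝 0) →
    Tendsto (fun n => Q (E n)) atTop (𝓝 0)

/-- The Blackwell–Dubins property: `P` merges with every finitely additive probability `Q ≪ P`. -/
def BlackwellDubins {S : MeasurableSpace Path} (hS : ContainsCylinders S)
    (P : events S → ℝ) : Prop :=
  ∀ Q ∈ finAddProb (events S), AbsCont Q P → Merges hS P Q

end Merging

end

/-!
Conditioning on the cylinders at time `t` projects the density of a charge `q ≤ r` with respect to
`r` onto finite partitions, and the squared `L²(r)`-norms of these projections increase and stay
bounded. By Pythagoras the projections are Cauchy, so they converge uniformly on all events, to a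
charge `L ≤ r` that agrees with `q` on every cylinder.

If `P` is extreme among the extensions of its restriction, then a charge below `P` is determined by
its values on the cylinders, since a difference `ν` of two such charges would give
`P = ((P + ν) + (P - ν)) / 2`; thus `L = q`, and applying this to `q = P (A ∩ ·)` shows that the
unions of cylinders are dense in the events for the pseudometric `P (A ∆ B)` (Plachky's theorem).
Unlike extremality, density passes to `P + Q` for `Q ≪ P`, and it again gives `L = q` there.
The projections of `Q` with respect to `P + Q` hence converge to `Q` uniformly on all events, and a
cylinder `C` on which the forecasts of `P` and `Q` differ by more than `ε` contributes at least
`ε * min (P C) (Q C) / 2` to the error; absolute continuity turns the smallness of the sum of these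
minima into merging.

Conversely, the components of a mixture equal to `P` are absolutely continuous with respect to `P`,
so the Blackwell–Dubins property makes `P` merge with them; and an extension with which `P` merges
coincides with `P`, because the two agree on every cylinder.
-/

noncomputable section

namespace Merging

open MeasureTheory Filter Topology
open scoped symmDiff

section Charge

variable {Ω : Type*} [MeasurableSpace Ω] {p q r : Set Ω → ℝ} {A B C E : Set Ω}

/-- A (positive, real-valued) charge: a nonnegative finitely additive set function on the
measurable sets. Its values on other sets are irrelevant. -/
structure IsCharge (p : Set Ω → ℝ) : Prop where
  nonneg : ∀ ⦃A⦄, MeasurableSet A → 0 ≤ p A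
  union : ∀ ⦃A B⦄, MeasurableSet A → MeasurableSet B → Disjoint A B → p (A ∪ B) = p A + p B

/-- `q` is a charge dominated by `r`; such a `q` plays the role of a set function with a density
with values in `[0, 1]` with respect to `r`. -/
structure IsSubcharge (q r : Set Ω → ℝ) : Prop extends IsCharge q where
  le : ∀ ⦃A⦄, MeasurableSet A → q A ≤ r A

/-- Absolute continuity `q ≪ p` in `ε`-`δ` form. -/
def UnifAbsCont (q p : Set Ω → ℝ) : Prop :=
  ∀ ε > 0, ∃ δ > 0, ∀ A, MeasurableSet A → p A < δ → q A < ε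

namespace IsCharge

theorem empty (hp : IsCharge p) : p ∅ = 0 := by
  simpa using hp.union .empty .empty (Set.disjoint_empty ∅)

theorem inter_add_diff (hp : IsCharge p) (hA : MeasurableSet A) (hB : MeasurableSet B) :
    p (A ∩ B) + p (A \ B) = p A := by
  rw [← hp.union (hA.inter hB) (hA.diff hB) Set.disjoint_sdiff_inter.symm, Set.inter_union_sdiff]

theorem mono (hp : IsCharge p) (hA : MeasurableSet A) (hB : MeasurableSet B) (h : A ⊆ B) :
    p A ≤ p B := by
  have hsplit := hp.inter_add_diff hB hA
  rw [Set.inter_eq_self_of_subset_right h] at hsplit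
  linarith [hp.nonneg (hB.diff hA)]

theorem inter_add_compl_inter (hp : IsCharge p) (hA : MeasurableSet A) (hB : MeasurableSet B) :
    p (A ∩ B) + p (Aᶜ ∩ B) = p B := by
  rw [Set.inter_comm A, Set.inter_comm Aᶜ, ← Set.sdiff_eq, hp.inter_add_diff hB hA]

theorem abs_sub_le_symmDiff (hp : IsCharge p) (hA : MeasurableSet A) (hB : MeasurableSet B) :
    |p A - p B| ≤ p (A ∆ B) := by
  have hsplitA := hp.inter_add_diff hA hB
  have hsplitB := hp.inter_add_diff hB hA
  rw [Set.inter_comm] at hsplitB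
  have hsymm : p (A ∆ B) = p (A \ B) + p (B \ A) :=
    hp.union (hA.diff hB) (hB.diff hA) disjoint_sdiff_sdiff
  have hAB := hp.nonneg (hA.diff hB)
  have hBA := hp.nonneg (hB.diff hA)
  exact abs_le.2 ⟨by linarith, by linarith⟩

theorem add (hp : IsCharge p) (hq : IsCharge q) : IsCharge (p + q) where
  nonneg _ hA := add_nonneg (hp.nonneg hA) (hq.nonneg hA)
  union _ _ hA hB h := by
    simp only [Pi.add_apply, hp.union hA hB h, hq.union hA hB h]
    ring

theorem isSubcharge_add (hp : IsCharge p) (hq : IsCharge q) : IsSubcharge q (p + q) where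
  toIsCharge := hq
  le _ hA := le_add_of_nonneg_left (hp.nonneg hA)

theorem isSubcharge_inter (hp : IsCharge p) (hA : MeasurableSet A) :
    IsSubcharge (fun B => p (A ∩ B)) p where
  nonneg _ hB := hp.nonneg (hA.inter hB)
  union B C hB hC h := by
    rw [Set.inter_union_distrib_left]
    exact hp.union (hA.inter hB) (hA.inter hC)
      (h.mono Set.inter_subset_right Set.inter_subset_right)
  le _ hB := hp.mono (hA.inter hB) hB Set.inter_subset_right

end IsCharge

namespace IsSubcharge

theorem div_mem_Icc (hq : IsSubcharge q r) (hA : MeasurableSet A) : q A / r A ∈ Set.Icc 0 1 :=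
  have hr := (hq.nonneg hA).trans (hq.le hA)
  ⟨div_nonneg (hq.nonneg hA) hr, div_le_one_of_le₀ (hq.le hA) hr⟩

theorem div_mul_cancel (hq : IsSubcharge q r) (hA : MeasurableSet A) : q A / r A * r A = q A :=
  div_mul_cancel_of_imp fun h => le_antisymm (h ▸ hq.le hA) (hq.nonneg hA)

end IsSubcharge

theorem abs_div_sub_div_le_one (hp : IsCharge p) (hq : IsCharge q) (hE : MeasurableSet E)
    (hC : MeasurableSet C) : |p (E ∩ C) / p C - q (E ∩ C) / q C| ≤ 1 := by
  simpa using abs_sub_le_of_le_of_le ((hp.isSubcharge_inter hE).div_mem_Icc hC).1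
    ((hp.isSubcharge_inter hE).div_mem_Icc hC).2 ((hq.isSubcharge_inter hE).div_mem_Icc hC).1
    ((hq.isSubcharge_inter hE).div_mem_Icc hC).2

end Charge

section FinitePartition

variable {Ω ι κ : Type*} [MeasurableSpace Ω] [MeasurableSpace ι] [DiscreteMeasurableSpace ι]
  [MeasurableSpace κ] [DiscreteMeasurableSpace κ] {f : Ω → ι} {g : Ω → κ}
  {p q r : Set Ω → ℝ} {E : Set Ω}

namespace IsCharge

theorem inter_preimage_eq_sum (hp : IsCharge p) (hf : Measurable f) (hE : MeasurableSet E)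
    (J : Finset ι) : p (E ∩ f ⁻¹' J) = ∑ i ∈ J, p (E ∩ f ⁻¹' {i}) := by
  classical
  induction J using Finset.induction_on with
  | empty => simp [hp.empty]
  | insert i J hi ih =>
    have hdisj : Disjoint (E ∩ f ⁻¹' {i}) (E ∩ f ⁻¹' J) :=
      (Disjoint.preimage f (by simpa using hi)).mono Set.inter_subset_right Set.inter_subset_right
    rw [Finset.sum_insert hi, ← ih, ← hp.union (hE.inter (hf .of_discrete))
      (hE.inter (hf .of_discrete)) hdisj, ← Set.inter_union_distrib_left, ← Set.preimage_union,
      Finset.coe_insert, Set.insert_eq]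

theorem eq_sum_inter (hp : IsCharge p) [Fintype ι] (hf : Measurable f) (hE : MeasurableSet E) :
    p E = ∑ i, p (E ∩ f ⁻¹' {i}) := by
  simp [← hp.inter_preimage_eq_sum hf hE]

theorem preimage_eq_sum (hp : IsCharge p) (hf : Measurable f) (J : Finset ι) :
    p (f ⁻¹' J) = ∑ i ∈ J, p (f ⁻¹' {i}) := by
  simpa using hp.inter_preimage_eq_sum hf .univ J

theorem univ_eq_sum (hp : IsCharge p) [Fintype ι] (hf : Measurable f) :
    p Set.univ = ∑ i, p (f ⁻¹' {i}) := by
  simpa using hp.eq_sum_inter hf .univ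

theorem preimage_congr (hp : IsCharge p) (hq : IsCharge q) [Finite ι] (hf : Measurable f)
    (h : ∀ i, p (f ⁻¹' {i}) = q (f ⁻¹' {i})) (J : Set ι) : p (f ⁻¹' J) = q (f ⁻¹' J) := by
  obtain ⟨K, rfl⟩ := J.toFinite.exists_finset_coe
  simp only [hp.preimage_eq_sum hf, hq.preimage_eq_sum hf, h]

theorem sum_comp_mul (hp : IsCharge p) [Fintype ι] {α : Type*} [Fintype α] (hf : Measurable f)
    (ρ : ι → α) (h : α → ℝ) (hE : MeasurableSet E) :
    ∑ i, h (ρ i) * p (E ∩ f ⁻¹' {i}) = ∑ a, h a * p (E ∩ ρ ∘ f ⁻¹' {a}) := by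
  classical
  rw [← Finset.sum_fiberwise Finset.univ ρ]
  refine Finset.sum_congr rfl fun a _ => ?_
  have hfiber : ρ ∘ f ⁻¹' {a} = f ⁻¹' ({i | ρ i = a} : Finset ι) := by ext; simp
  rw [hfiber, hp.inter_preimage_eq_sum hf hE, Finset.mul_sum]
  refine Finset.sum_congr rfl fun i hi => ?_
  rw [(Finset.mem_filter.1 hi).2]

end IsCharge

/-- The conditional expectation, given the finite partition into the fibres of `f`, of the density
of `q` with respect to `r`, as a function of the cell (`0` on a cell with `r`-mass `0`). -/
def cellDensity (f : Ω → ι) (r q : Set Ω → ℝ) (i : ι) : ℝ := q (f ⁻¹' {i}) / r (f ⁻¹' {i})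

/-- The set function whose density with respect to `r` is `cellDensity f r q`, that is, the
orthogonal projection in `L²(r)` of the density of `q` onto the functions of `f`. -/
def cellProj [Fintype ι] (f : Ω → ι) (r q : Set Ω → ℝ) (E : Set Ω) : ℝ :=
  ∑ i, cellDensity f r q i * r (E ∩ f ⁻¹' {i})

/-- The squared `L²(r)`-norm of `cellDensity f r q`. -/
def energy [Fintype ι] (f : Ω → ι) (r q : Set Ω → ℝ) : ℝ :=
  ∑ i, cellDensity f r q i ^ 2 * r (f ⁻¹' {i})

namespace IsSubcharge

theorem cellDensity_mem_Icc (hq : IsSubcharge q r) (hf : Measurable f) (i : ι) :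
    cellDensity f r q i ∈ Set.Icc 0 1 :=
  hq.div_mem_Icc (hf .of_discrete)

theorem cellDensity_mul_cell (hq : IsSubcharge q r) (hf : Measurable f) (i : ι) :
    cellDensity f r q i * r (f ⁻¹' {i}) = q (f ⁻¹' {i}) :=
  hq.div_mul_cancel (hf .of_discrete)

variable [Fintype ι]

theorem cellProj (hq : IsSubcharge q r) (hr : IsCharge r) (hf : Measurable f) :
    IsSubcharge (cellProj f r q) r where
  nonneg E hE := Finset.sum_nonneg fun i _ =>
    mul_nonneg (hq.cellDensity_mem_Icc hf i).1 (hr.nonneg (hE.inter (hf .of_discrete)))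
  union E F hE hF h := by
    simp only [Merging.cellProj, ← Finset.sum_add_distrib, ← mul_add]
    refine Finset.sum_congr rfl fun i _ => ?_
    rw [Set.union_inter_distrib_right, hr.union (hE.inter (hf .of_discrete))
      (hF.inter (hf .of_discrete)) (h.mono Set.inter_subset_left Set.inter_subset_left)]
  le E hE := by
    rw [hr.eq_sum_inter hf hE]
    exact Finset.sum_le_sum fun i _ => mul_le_of_le_one_left
      (hr.nonneg (hE.inter (hf .of_discrete))) (hq.cellDensity_mem_Icc hf i).2

theorem cellProj_cell (hq : IsSubcharge q r) (hr : IsCharge r) (hf : Measurable f) (i : ι) :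
    Merging.cellProj f r q (f ⁻¹' {i}) = q (f ⁻¹' {i}) := by
  rw [Merging.cellProj, Finset.sum_eq_single i, Set.inter_self, hq.cellDensity_mul_cell hf]
  · intro j _ hj
    rw [← Set.preimage_inter, Set.singleton_inter_eq_empty.2 (by simpa using hj.symm),
      Set.preimage_empty, hr.empty, mul_zero]
  · simp

theorem cellProj_preimage (hq : IsSubcharge q r) (hr : IsCharge r) (hf : Measurable f)
    (J : Set ι) : Merging.cellProj f r q (f ⁻¹' J) = q (f ⁻¹' J) :=
  (hq.cellProj hr hf).preimage_congr hq.toIsCharge hf (hq.cellProj_cell hr hf) J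

theorem energy_eq_sum (hq : IsSubcharge q r) (hf : Measurable f) :
    energy f r q = ∑ i, cellDensity f r q i * q (f ⁻¹' {i}) :=
  Finset.sum_congr rfl fun i _ => by rw [← hq.cellDensity_mul_cell hf i]; ring

theorem energy_le (hq : IsSubcharge q r) (hf : Measurable f) : energy f r q ≤ q Set.univ := by
  rw [hq.energy_eq_sum hf, hq.univ_eq_sum hf]
  exact Finset.sum_le_sum fun i _ => mul_le_of_le_one_left
    (hq.nonneg (hf .of_discrete)) (hq.cellDensity_mem_Icc hf i).2

variable [Fintype κ]

-- Pythagoras: the density given `ρ ∘ g` is the projection of the density given `g`.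
theorem sum_sq_cellDensity_sub (hq : IsSubcharge q r) (hr : IsCharge r) (hg : Measurable g)
    (ρ : κ → ι) :
    ∑ j, (cellDensity g r q j - cellDensity (ρ ∘ g) r q (ρ j)) ^ 2 * r (g ⁻¹' {j}) =
      energy g r q - energy (ρ ∘ g) r q := by
  have hρg : Measurable (ρ ∘ g) := .comp .of_discrete hg
  have hcross : ∑ j, cellDensity (ρ ∘ g) r q (ρ j) * q (g ⁻¹' {j}) = energy (ρ ∘ g) r q := by
    rw [hq.energy_eq_sum hρg]
    simpa using hq.sum_comp_mul hg ρ (cellDensity (ρ ∘ g) r q) .univ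
  have hcoarse : ∑ j, cellDensity (ρ ∘ g) r q (ρ j) ^ 2 * r (g ⁻¹' {j}) =
      energy (ρ ∘ g) r q := by
    simpa [energy] using hr.sum_comp_mul hg ρ (cellDensity (ρ ∘ g) r q · ^ 2) .univ
  calc ∑ j, (cellDensity g r q j - cellDensity (ρ ∘ g) r q (ρ j)) ^ 2 * r (g ⁻¹' {j})
      = energy g r q - 2 * ∑ j, cellDensity (ρ ∘ g) r q (ρ j) * q (g ⁻¹' {j}) +
          ∑ j, cellDensity (ρ ∘ g) r q (ρ j) ^ 2 * r (g ⁻¹' {j}) := by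
        simp only [energy, Finset.mul_sum, ← Finset.sum_sub_distrib, ← Finset.sum_add_distrib,
          ← hq.cellDensity_mul_cell hg]
        exact Finset.sum_congr rfl fun j _ => by ring
    _ = energy g r q - energy (ρ ∘ g) r q := by rw [hcross, hcoarse]; ring

theorem energy_comp_le (hq : IsSubcharge q r) (hr : IsCharge r) (hg : Measurable g) (ρ : κ → ι) :
    energy (ρ ∘ g) r q ≤ energy g r q := by
  rw [← sub_nonneg, ← hq.sum_sq_cellDensity_sub hr hg]
  exact Finset.sum_nonneg fun j _ => mul_nonneg (sq_nonneg _) (hr.nonneg (hg .of_discrete))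

theorem sq_cellProj_sub_le (hq : IsSubcharge q r) (hr : IsCharge r) (hg : Measurable g)
    (ρ : κ → ι) (hE : MeasurableSet E) :
    (Merging.cellProj g r q E - Merging.cellProj (ρ ∘ g) r q E) ^ 2 ≤
      (energy g r q - energy (ρ ∘ g) r q) * r Set.univ := by
  have hcell (j : κ) : MeasurableSet (g ⁻¹' {j}) := hg .of_discrete
  have hle (j : κ) : r (E ∩ g ⁻¹' {j}) ≤ r (g ⁻¹' {j}) :=
    hr.mono (hE.inter (hcell j)) (hcell j) Set.inter_subset_right
  set d : κ → ℝ := fun j => cellDensity g r q j - cellDensity (ρ ∘ g) r q (ρ j)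
  have hdiff : Merging.cellProj g r q E - Merging.cellProj (ρ ∘ g) r q E =
      ∑ j, d j * r (E ∩ g ⁻¹' {j}) := by
    rw [Merging.cellProj, Merging.cellProj,
      ← hr.sum_comp_mul hg ρ (cellDensity (ρ ∘ g) r q) hE, ← Finset.sum_sub_distrib]
    exact Finset.sum_congr rfl fun j _ => (sub_mul _ _ _).symm
  calc (Merging.cellProj g r q E - Merging.cellProj (ρ ∘ g) r q E) ^ 2
      ≤ (∑ j, d j ^ 2 * r (E ∩ g ⁻¹' {j})) * ∑ j, r (E ∩ g ⁻¹' {j}) := by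
        rw [hdiff]
        exact Finset.sum_sq_le_sum_mul_sum_of_sq_le_mul _
          (fun j _ => mul_nonneg (sq_nonneg _) (hr.nonneg (hE.inter (hcell j))))
          (fun j _ => hr.nonneg (hE.inter (hcell j)))
          fun j _ => by rw [mul_pow, mul_assoc, sq (r _)]
    _ ≤ (∑ j, d j ^ 2 * r (g ⁻¹' {j})) * ∑ j, r (g ⁻¹' {j}) := by
        gcongr with j _ j _
        · exact Finset.sum_nonneg fun j _ => hr.nonneg (hE.inter (hcell j))
        · exact Finset.sum_nonneg fun j _ => mul_nonneg (sq_nonneg _) (hr.nonneg (hcell j))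
        · exact hle j
        · exact hle j
    _ = (energy g r q - energy (ρ ∘ g) r q) * r Set.univ := by
        rw [hq.sum_sq_cellDensity_sub hr hg, hr.univ_eq_sum hg]

end IsSubcharge

theorem min_le_two_mul_mul_div_add {a b : ℝ} (ha : 0 ≤ a) (hb : 0 ≤ b) :
    min a b ≤ 2 * (a * b / (a + b)) := by
  rcases (add_nonneg ha hb).eq_or_lt with h0 | hpos
  · rw [← h0, div_zero, mul_zero]
    exact (min_le_left a b).trans (by linarith)
  · rw [← mul_div_assoc, le_div_iff₀ hpos]
    rcases le_total a b with h | h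
    · rw [min_eq_left h]
      nlinarith
    · rw [min_eq_right h]
      nlinarith

theorem IsCharge.exists_symmDiff_preimage_le [Fintype ι] (hp : IsCharge p) (hf : Measurable f)
    (hE : MeasurableSet E) :
    ∃ J : Set ι, p (E ∆ (f ⁻¹' J)) ≤ 2 * cellProj f p (fun B => p (E ∩ B)) Eᶜ := by
  have hcell (i : ι) : MeasurableSet (f ⁻¹' {i}) := hf .of_discrete
  set J : Set ι := {i | p (Eᶜ ∩ f ⁻¹' {i}) ≤ p (E ∩ f ⁻¹' {i})}
  have hmin (i : ι) : p (E ∆ (f ⁻¹' J) ∩ f ⁻¹' {i}) =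
      min (p (E ∩ f ⁻¹' {i})) (p (Eᶜ ∩ f ⁻¹' {i})) := by
    by_cases hi : i ∈ J
    · have : E ∆ (f ⁻¹' J) ∩ f ⁻¹' {i} = Eᶜ ∩ f ⁻¹' {i} := by grind
      rw [this, min_eq_right hi]
    · have : E ∆ (f ⁻¹' J) ∩ f ⁻¹' {i} = E ∩ f ⁻¹' {i} := by grind
      rw [this, min_eq_left (not_le.1 hi).le]
  refine ⟨J, ?_⟩
  rw [hp.eq_sum_inter hf (hE.symmDiff (hf .of_discrete)), cellProj, Finset.mul_sum]
  refine Finset.sum_le_sum fun i _ => ?_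
  rw [hmin, cellDensity, div_mul_eq_mul_div, ← hp.inter_add_compl_inter hE (hcell i)]
  exact min_le_two_mul_mul_div_add (hp.nonneg (hE.inter (hcell i)))
    (hp.nonneg (hE.compl.inter (hcell i)))

/-- The cells of the partition into the fibres of `f` on which the conditional probabilities under
`p` and `q` of some event differ by more than `ε`. -/
def discordantCells (f : Ω → ι) (p q : Set Ω → ℝ) (ε : ℝ) : Set ι :=
  {i | ∃ E, MeasurableSet E ∧
    ε < |p (E ∩ f ⁻¹' {i}) / p (f ⁻¹' {i}) - q (E ∩ f ⁻¹' {i}) / q (f ⁻¹' {i})|}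

theorem abs_sub_le_of_cells_eq [Finite ι] (hp : IsCharge p) (hq : IsCharge q)
    (hf : Measurable f) (hpq : ∀ i, p (f ⁻¹' {i}) = q (f ⁻¹' {i})) {ε : ℝ} (hε : 0 ≤ ε)
    (hE : MeasurableSet E) :
    |p E - q E| ≤ ε * q Set.univ + q (f ⁻¹' discordantCells f p q ε) := by
  classical
  have := Fintype.ofFinite ι
  have hcell (i : ι) : MeasurableSet (f ⁻¹' {i}) := hf .of_discrete
  set D : Finset ι := (discordantCells f p q ε).toFinset with hD
  have hbound (i : ι) : |p (E ∩ f ⁻¹' {i}) - q (E ∩ f ⁻¹' {i})| ≤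
      ε * q (f ⁻¹' {i}) + if i ∈ D then q (f ⁻¹' {i}) else 0 := by
    have hq0 := hq.nonneg (hcell i)
    have hcond : |p (E ∩ f ⁻¹' {i}) - q (E ∩ f ⁻¹' {i})| =
        |p (E ∩ f ⁻¹' {i}) / p (f ⁻¹' {i}) - q (E ∩ f ⁻¹' {i}) / q (f ⁻¹' {i})| *
          q (f ⁻¹' {i}) := by
      rw [← abs_of_nonneg hq0, ← abs_mul, abs_of_nonneg hq0, sub_mul,
        (hq.isSubcharge_inter hE).div_mul_cancel (hcell i), ← hpq,
        (hp.isSubcharge_inter hE).div_mul_cancel (hcell i)]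
    rw [hcond]
    split_ifs with hi
    · exact (mul_le_of_le_one_left hq0 (abs_div_sub_div_le_one hp hq hE (hcell i))).trans
        (le_add_of_nonneg_left (mul_nonneg hε hq0))
    · rw [add_zero]
      refine mul_le_mul_of_nonneg_right (not_lt.1 fun hlt => hi ?_) hq0
      exact Set.mem_toFinset.2 ⟨E, hE, hlt⟩
  calc |p E - q E|
      = |∑ i, (p (E ∩ f ⁻¹' {i}) - q (E ∩ f ⁻¹' {i}))| := by
        rw [hp.eq_sum_inter hf hE, hq.eq_sum_inter hf hE, Finset.sum_sub_distrib]
    _ ≤ ∑ i, (ε * q (f ⁻¹' {i}) + if i ∈ D then q (f ⁻¹' {i}) else 0) :=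
        (Finset.abs_sum_le_sum_abs _ _).trans (Finset.sum_le_sum fun i _ => hbound i)
    _ = ε * q Set.univ + ∑ i ∈ D, q (f ⁻¹' {i}) := by
        simp [Finset.sum_add_distrib, ← Finset.mul_sum, hq.univ_eq_sum hf]
    _ = ε * q Set.univ + q (f ⁻¹' discordantCells f p q ε) := by
        rw [← hq.preimage_eq_sum hf, hD, Set.coe_toFinset]

theorem exists_inter_preimage_singleton_eq [Countable ι] (hf : Measurable f) {E : ι → Set Ω}
    (hE : ∀ i, MeasurableSet (E i)) :
    ∃ F, MeasurableSet F ∧ ∀ i, F ∩ f ⁻¹' {i} = E i ∩ f ⁻¹' {i} :=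
  ⟨⋃ i, E i ∩ f ⁻¹' {i}, .iUnion fun i => (hE i).inter (hf .of_discrete), fun i => by
    ext; simp +contextual⟩

-- Passing to the complement of the event that separates `p` from `q` removes the absolute value.
theorem exists_mul_le_of_mem_discordantCells (hp : IsCharge p) (hq : IsCharge q)
    (hf : Measurable f) {ε : ℝ} {i : ι} (hi : i ∈ discordantCells f p q ε) :
    ∃ E, MeasurableSet E ∧
      ε * (p (f ⁻¹' {i}) * q (f ⁻¹' {i}) / (p (f ⁻¹' {i}) + q (f ⁻¹' {i}))) ≤
        q (E ∩ f ⁻¹' {i}) - cellDensity f (p + q) q i * (p + q) (E ∩ f ⁻¹' {i}) := by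
  obtain ⟨E, hE, hlt⟩ := hi
  have hC : MeasurableSet (f ⁻¹' {i}) := hf .of_discrete
  rw [cellDensity]
  simp only [Pi.add_apply]
  have hpE := hp.inter_add_compl_inter hE hC
  have hqE := hq.inter_add_compl_inter hE hC
  set C := f ⁻¹' {i}
  rcases (hp.nonneg hC).eq_or_lt with hp0 | hp0
  · exact ⟨∅, .empty, by simp [← hp0, hp.empty, hq.empty]⟩
  rcases (hq.nonneg hC).eq_or_lt with hq0 | hq0
  · exact ⟨∅, .empty, by simp [← hq0, hp.empty, hq.empty]⟩
  have hgap (x y : ℝ) : y - q C / (p C + q C) * (x + y) =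
      (y / q C - x / p C) * (p C * q C / (p C + q C)) := by
    field_simp
    ring
  simp only [hgap]
  rcases lt_abs.1 hlt with hlt | hlt
  · refine ⟨Eᶜ, hE.compl, mul_le_mul_of_nonneg_right ?_ (by positivity)⟩
    rw [eq_sub_of_add_eq' hpE, eq_sub_of_add_eq' hqE, sub_div, sub_div, div_self hp0.ne',
      div_self hq0.ne']
    linarith
  · refine ⟨E, hE, mul_le_mul_of_nonneg_right ?_ (by positivity)⟩
    linarith

theorem mul_sum_min_discordantCells_le [Fintype ι] (hp : IsCharge p) (hq : IsCharge q)
    (hf : Measurable f) {ε c : ℝ} (hε : 0 ≤ ε)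
    (hc : ∀ E, MeasurableSet E → q E - cellProj f (p + q) q E ≤ c) {J : Finset ι}
    (hJ : ↑J ⊆ discordantCells f p q ε) :
    ε * ∑ i ∈ J, min (p (f ⁻¹' {i})) (q (f ⁻¹' {i})) ≤ 2 * c := by
  classical
  set m : ι → ℝ := fun i =>
    p (f ⁻¹' {i}) * q (f ⁻¹' {i}) / (p (f ⁻¹' {i}) + q (f ⁻¹' {i}))
  have hwitness (i : ι) : ∃ E, MeasurableSet E ∧ (if i ∈ J then ε * m i else 0) ≤
      q (E ∩ f ⁻¹' {i}) - cellDensity f (p + q) q i * (p + q) (E ∩ f ⁻¹' {i}) := by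
    split_ifs with hi
    · exact exists_mul_le_of_mem_discordantCells hp hq hf (hJ hi)
    · exact ⟨∅, .empty, by simp [hp.empty, hq.empty]⟩
  choose E hE hEm using hwitness
  obtain ⟨F, hF, hFE⟩ := exists_inter_preimage_singleton_eq hf hE
  have hsum : ε * ∑ i ∈ J, m i ≤ c :=
    calc ε * ∑ i ∈ J, m i = ∑ i, if i ∈ J then ε * m i else 0 := by
          simp [Finset.mul_sum]
      _ ≤ ∑ i, (q (F ∩ f ⁻¹' {i}) - cellDensity f (p + q) q i * (p + q) (F ∩ f ⁻¹' {i})) := by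
          simp only [hFE]
          exact Finset.sum_le_sum fun i _ => hEm i
      _ = q F - cellProj f (p + q) q F := by
          rw [hq.eq_sum_inter hf hF, cellProj, Finset.sum_sub_distrib]
      _ ≤ c := hc F hF
  calc ε * ∑ i ∈ J, min (p (f ⁻¹' {i})) (q (f ⁻¹' {i}))
      ≤ ε * ∑ i ∈ J, 2 * m i := by
        gcongr with i
        exact min_le_two_mul_mul_div_add (hp.nonneg (hf .of_discrete)) (hq.nonneg (hf .of_discrete))
    _ = 2 * (ε * ∑ i ∈ J, m i) := by rw [← Finset.mul_sum, mul_left_comm]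
    _ ≤ 2 * c := by gcongr

theorem preimage_lt_add_of_sum_min_lt (hp : IsCharge p) (hq : IsCharge q) (hf : Measurable f)
    {δ η : ℝ} (hqp : ∀ A, MeasurableSet A → p A < δ → q A < η) {J : Finset ι}
    (hδ : ∑ i ∈ J, min (p (f ⁻¹' {i})) (q (f ⁻¹' {i})) < δ)
    (hη : ∑ i ∈ J, min (p (f ⁻¹' {i})) (q (f ⁻¹' {i})) < η) : q (f ⁻¹' J) < η + η := by
  classical
  set K : Finset ι := {i ∈ J | p (f ⁻¹' {i}) ≤ q (f ⁻¹' {i})}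
  set L : Finset ι := {i ∈ J | ¬ p (f ⁻¹' {i}) ≤ q (f ⁻¹' {i})}
  have hmin : ∑ i ∈ J, min (p (f ⁻¹' {i})) (q (f ⁻¹' {i})) =
      p (f ⁻¹' K) + q (f ⁻¹' L) := by
    rw [hp.preimage_eq_sum hf, hq.preimage_eq_sum hf, ← Finset.sum_filter_add_sum_filter_not J
      fun i => p (f ⁻¹' {i}) ≤ q (f ⁻¹' {i})]
    congr 1
    · exact Finset.sum_congr rfl fun i hi => min_eq_left (Finset.mem_filter.1 hi).2
    · exact Finset.sum_congr rfl fun i hi => min_eq_right (not_le.1 (Finset.mem_filter.1 hi).2).le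
  have hsplit : q (f ⁻¹' J) = q (f ⁻¹' K) + q (f ⁻¹' L) := by
    simp only [hq.preimage_eq_sum hf]
    exact (Finset.sum_filter_add_sum_filter_not J _ _).symm
  have hpK := hp.nonneg (hf (.of_discrete (s := (K : Set ι))))
  have hqL := hq.nonneg (hf (.of_discrete (s := (L : Set ι))))
  have hqK : q (f ⁻¹' K) < η := hqp _ (hf .of_discrete) (by linarith)
  linarith

end FinitePartition

section Refining

variable {Ω T : Type*} [MeasurableSpace Ω] [Preorder T] {ι : T → Type*}
  [∀ t, MeasurableSpace (ι t)] [∀ t, DiscreteMeasurableSpace (ι t)] {π : ∀ t, Ω → ι t}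
  {p q r : Set Ω → ℝ}

/-- Partitions of `Ω` into measurable sets that become finer with time, the partition at time `t`
being the one into the fibres of `π t`. -/
structure IsRefining (π : ∀ t, Ω → ι t) : Prop where
  measurable : ∀ t, Measurable (π t)
  factor : ∀ ⦃s t⦄, s ≤ t → ∃ ρ : ι t → ι s, π s = ρ ∘ π t

/-- A charge dominated by `r` is determined by its values on the cells of the partitions `π t`. -/
def CellsDetermine (π : ∀ t, Ω → ι t) (r : Set Ω → ℝ) : Prop :=
  ∀ ⦃μ ν⦄, IsSubcharge μ r → IsSubcharge ν r → (∀ t i, μ (π t ⁻¹' {i}) = ν (π t ⁻¹' {i})) →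
    ∀ A, MeasurableSet A → μ A = ν A

/-- Every measurable set is approximated in `p` by unions of cells of the partitions `π t`. -/
def CellsDense (π : ∀ t, Ω → ι t) (p : Set Ω → ℝ) : Prop :=
  ∀ A, MeasurableSet A → ∀ ε > 0, ∃ t, ∃ J : Set (ι t), p (A ∆ (π t ⁻¹' J)) < ε

/-- `p` merges with `q` along the partitions `π t`: the conditional probabilities given the cell
at time `t` become uniformly close in `q`-probability. -/
def MergesAlong (π : ∀ t, Ω → ι t) (p q : Set Ω → ℝ) : Prop :=
  ∀ ε > 0, Tendsto (fun t => q (π t ⁻¹' discordantCells (π t) p q ε)) atTop (𝓝 0)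

namespace IsRefining

variable [∀ t, Fintype (ι t)]

theorem monotone_energy (hπ : IsRefining π) (hr : IsCharge r) (hq : IsSubcharge q r) :
    Monotone fun t => energy (π t) r q := by
  intro s t hst
  obtain ⟨ρ, hρ⟩ := hπ.factor hst
  simpa only [hρ] using hq.energy_comp_le hr (hπ.measurable t) ρ

theorem sq_cellProj_sub_le (hπ : IsRefining π) (hr : IsCharge r) (hq : IsSubcharge q r)
    {s t : T} (hst : s ≤ t) {E : Set Ω} (hE : MeasurableSet E) :
    (cellProj (π t) r q E - cellProj (π s) r q E) ^ 2 ≤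
      (energy (π t) r q - energy (π s) r q) * r Set.univ := by
  obtain ⟨ρ, hρ⟩ := hπ.factor hst
  simpa only [hρ] using hq.sq_cellProj_sub_le hr (hπ.measurable t) ρ hE

theorem cellProj_cell_of_le (hπ : IsRefining π) (hr : IsCharge r) (hq : IsSubcharge q r)
    {s t : T} (hst : s ≤ t) (i : ι s) : cellProj (π t) r q (π s ⁻¹' {i}) = q (π s ⁻¹' {i}) := by
  obtain ⟨ρ, hρ⟩ := hπ.factor hst
  rw [hρ, Set.preimage_comp, hq.cellProj_preimage hr (hπ.measurable t)]

end IsRefining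

theorem CellsDense.cellsDetermine [∀ t, Finite (ι t)] (h : CellsDense π r) (hπ : IsRefining π) :
    CellsDetermine π r := by
  intro μ ν hμ hν hcells A hA
  refine eq_of_forall_dist_le fun ε hε => ?_
  obtain ⟨t, J, hJ⟩ := h A hA (ε / 2) (half_pos hε)
  have hF : MeasurableSet (π t ⁻¹' J) := hπ.measurable t .of_discrete
  have hμν : μ (π t ⁻¹' J) = ν (π t ⁻¹' J) :=
    hμ.preimage_congr hν.toIsCharge (hπ.measurable t) (hcells t) J
  have happrox {σ : Set Ω → ℝ} (hσ : IsSubcharge σ r) : dist (σ A) (σ (π t ⁻¹' J)) ≤ ε / 2 :=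
    (hσ.abs_sub_le_symmDiff hA hF).trans ((hσ.le (hA.symmDiff hF)).trans hJ.le)
  calc dist (μ A) (ν A)
      ≤ dist (μ A) (μ (π t ⁻¹' J)) + dist (ν A) (μ (π t ⁻¹' J)) := dist_triangle_right _ _ _
    _ ≤ ε / 2 + ε / 2 := add_le_add (happrox hμ) (hμν ▸ happrox hν)
    _ = ε := add_halves ε

theorem CellsDense.add (h : CellsDense π p) (hπ : IsRefining π) (hqp : UnifAbsCont q p) :
    CellsDense π (p + q) := by
  intro A hA ε hε
  obtain ⟨δ, hδ, hpq⟩ := hqp (ε / 2) (half_pos hε)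
  obtain ⟨t, J, hJ⟩ := h A hA (min δ (ε / 2)) (lt_min hδ (half_pos hε))
  refine ⟨t, J, ?_⟩
  have hqA := hpq _ (hA.symmDiff (hπ.measurable t .of_discrete)) (hJ.trans_le (min_le_left _ _))
  have hpA := hJ.trans_le (min_le_right _ _)
  simpa using add_lt_add hpA hqA

end Refining

section Convergence

variable {Ω T : Type*} [MeasurableSpace Ω] [SemilatticeSup T] [Nonempty T] {ι : T → Type*}
  [∀ t, MeasurableSpace (ι t)] [∀ t, DiscreteMeasurableSpace (ι t)] {π : ∀ t, Ω → ι t}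
  {p q r : Set Ω → ℝ}

namespace IsRefining

variable [∀ t, Fintype (ι t)]

theorem uniformCauchySeqOn_cellProj (hπ : IsRefining π) (hr : IsCharge r)
    (hq : IsSubcharge q r) :
    UniformCauchySeqOn (fun t => cellProj (π t) r q) atTop {E | MeasurableSet E} := by
  have henergy : CauchySeq fun t => energy (π t) r q :=
    (tendsto_atTop_ciSup (hπ.monotone_energy hr hq)
      ⟨q Set.univ, Set.forall_mem_range.2 fun t => hq.energy_le (hπ.measurable t)⟩).cauchySeq
  have hmass : 0 ≤ r Set.univ := hr.nonneg .univ
  refine Metric.uniformCauchySeqOn_iff.2 fun ε hε => ?_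
  obtain ⟨N, hN⟩ := Metric.cauchySeq_iff'.1 henergy ((ε / 2) ^ 2 / (r Set.univ + 1)) (by positivity)
  have hclose : ∀ t ≥ N, ∀ E, MeasurableSet E →
      dist (cellProj (π t) r q E) (cellProj (π N) r q E) < ε / 2 := by
    intro t ht E hE
    refine abs_lt_of_sq_lt_sq ?_ (half_pos hε).le
    calc (cellProj (π t) r q E - cellProj (π N) r q E) ^ 2
        ≤ (energy (π t) r q - energy (π N) r q) * r Set.univ :=
          hπ.sq_cellProj_sub_le hr hq ht hE
      _ ≤ (energy (π t) r q - energy (π N) r q) * (r Set.univ + 1) :=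
          mul_le_mul_of_nonneg_left (by linarith) (sub_nonneg.2 (hπ.monotone_energy hr hq ht))
      _ < (ε / 2) ^ 2 := (lt_div_iff₀ (by positivity)).1 ((le_abs_self _).trans_lt (hN t ht))
  refine ⟨N, fun s hs t ht E hE => ?_⟩
  calc dist (cellProj (π s) r q E) (cellProj (π t) r q E)
      ≤ dist (cellProj (π s) r q E) (cellProj (π N) r q E) +
          dist (cellProj (π t) r q E) (cellProj (π N) r q E) := dist_triangle_right _ _ _
    _ < ε / 2 + ε / 2 := add_lt_add (hclose s hs E hE) (hclose t ht E hE)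
    _ = ε := add_halves ε

theorem exists_tendstoUniformlyOn_cellProj (hπ : IsRefining π) (hr : IsCharge r)
    (hq : IsSubcharge q r) :
    ∃ L, IsSubcharge L r ∧ (∀ t i, L (π t ⁻¹' {i}) = q (π t ⁻¹' {i})) ∧
      TendstoUniformlyOn (fun t => cellProj (π t) r q) L atTop {E | MeasurableSet E} := by
  have hcauchy := hπ.uniformCauchySeqOn_cellProj hr hq
  have hproj (t : T) : IsSubcharge (cellProj (π t) r q) r := hq.cellProj hr (hπ.measurable t)
  choose! L hL using fun E (hE : MeasurableSet E) =>
    cauchySeq_tendsto_of_complete (hcauchy.cauchySeq hE)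
  refine ⟨L, ⟨⟨fun A hA => ?_, fun A B hA hB h => ?_⟩, fun A hA => ?_⟩, fun t i => ?_,
    hcauchy.tendstoUniformlyOn_of_tendsto hL⟩
  · exact ge_of_tendsto' (hL A hA) fun t => (hproj t).nonneg hA
  · refine tendsto_nhds_unique (hL _ (hA.union hB)) (((hL A hA).add (hL B hB)).congr fun t => ?_)
    exact ((hproj t).union hA hB h).symm
  · exact le_of_tendsto' (hL A hA) fun t => (hproj t).le hA
  · refine tendsto_nhds_unique (hL _ (hπ.measurable t .of_discrete)) ?_
    refine tendsto_const_nhds.congr' ?_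
    filter_upwards [eventually_ge_atTop t] with u hu
    exact (hπ.cellProj_cell_of_le hr hq hu i).symm

end IsRefining

theorem CellsDetermine.tendstoUniformlyOn_cellProj [∀ t, Fintype (ι t)]
    (h : CellsDetermine π r) (hπ : IsRefining π) (hr : IsCharge r) (hq : IsSubcharge q r) :
    TendstoUniformlyOn (fun t => cellProj (π t) r q) q atTop {E | MeasurableSet E} := by
  obtain ⟨L, hL, hcells, hlim⟩ := hπ.exists_tendstoUniformlyOn_cellProj hr hq
  exact hlim.congr_right fun E hE => h hL hq hcells E hE

-- The density of `p (A ∩ ·)` is the indicator of `A`, so its projections have small mass on `Aᶜ`.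
theorem CellsDetermine.cellsDense [∀ t, Finite (ι t)]
    (h : CellsDetermine π p) (hπ : IsRefining π) (hp : IsCharge p) : CellsDense π p := by
  have (t : T) := Fintype.ofFinite (ι t)
  intro A hA ε hε
  have hlim : Tendsto (fun t => cellProj (π t) p (fun B => p (A ∩ B)) Aᶜ) atTop (𝓝 0) := by
    simpa [hp.empty] using
      (h.tendstoUniformlyOn_cellProj hπ hp (hp.isSubcharge_inter hA)).tendsto_at hA.compl
  obtain ⟨t, ht⟩ := (hlim.eventually (gt_mem_nhds (half_pos hε))).exists
  obtain ⟨J, hJ⟩ := hp.exists_symmDiff_preimage_le (hπ.measurable t) hA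
  exact ⟨t, J, by linarith⟩

variable [∀ t, Finite (ι t)]

theorem CellsDetermine.mergesAlong (h : CellsDetermine π p) (hπ : IsRefining π)
    (hp : IsCharge p) (hq : IsCharge q) (hqp : UnifAbsCont q p) : MergesAlong π p q := by
  have (t : T) := Fintype.ofFinite (ι t)
  have hdet : CellsDetermine π (p + q) :=
    ((h.cellsDense hπ hp).add hπ hqp).cellsDetermine hπ
  have hunif := hdet.tendstoUniformlyOn_cellProj hπ (hp.add hq) (hp.isSubcharge_add hq)
  intro ε hε
  refine Metric.tendsto_nhds.2 fun η hη => ?_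
  obtain ⟨δ, hδ, hδη⟩ := hqp (η / 2) (half_pos hη)
  set c := ε * min δ (η / 2) / 4 with hc
  have hm : 0 < min δ (η / 2) := lt_min hδ (half_pos hη)
  filter_upwards [Metric.tendstoUniformlyOn_iff.1 hunif c (by positivity)] with t ht
  obtain ⟨J, hJ⟩ := (discordantCells (π t) p q ε).toFinite.exists_finset_coe
  have hmin : ∑ i ∈ J, min (p (π t ⁻¹' {i})) (q (π t ⁻¹' {i})) < min δ (η / 2) := by
    have hle := mul_sum_min_discordantCells_le hp hq (hπ.measurable t) hε.le
      (fun E hE => ((le_abs_self _).trans_lt (ht E hE)).le) hJ.le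
    refine lt_of_mul_lt_mul_left (hle.trans_lt ?_) hε.le
    rw [hc]
    linarith [mul_pos hε hm]
  have hlt := preimage_lt_add_of_sum_min_lt hp hq (hπ.measurable t) hδη
    (hmin.trans_le (min_le_left _ _)) (hmin.trans_le (min_le_right _ _))
  rwa [add_halves, hJ, ← abs_of_nonneg (hq.nonneg (hπ.measurable t .of_discrete)),
    ← Real.dist_0_eq_abs] at hlt

theorem MergesAlong.eq_of_cells_eq (h : MergesAlong π p q) (hπ : IsRefining π) (hp : IsCharge p)
    (hq : IsCharge q) (hpq : ∀ t i, p (π t ⁻¹' {i}) = q (π t ⁻¹' {i})) {E : Set Ω}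
    (hE : MeasurableSet E) : p E = q E := by
  have hbound {ε : ℝ} (hε : 0 < ε) : |p E - q E| ≤ ε * q Set.univ := by
    have hlim := (h ε hε).const_add (ε * q Set.univ)
    rw [add_zero] at hlim
    exact ge_of_tendsto' hlim fun t =>
      abs_sub_le_of_cells_eq hp hq (hπ.measurable t) (hpq t) hε.le hE
  have hmass : 0 ≤ q Set.univ := hq.nonneg .univ
  refine eq_of_forall_dist_le fun ε hε => ?_
  calc dist (p E) (q E) ≤ ε / (q Set.univ + 1) * q Set.univ := hbound (by positivity)
    _ ≤ ε / (q Set.univ + 1) * (q Set.univ + 1) := by gcongr; linarith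
    _ = ε := div_mul_cancel₀ _ (by positivity)

end Convergence

section Path

variable {S : MeasurableSpace Path} {P Q R : events S → ℝ}

/-- The first `t` coordinates of a path; the fibres of `word t` are the cylinders `ω^t`. -/
def word (t : ℕ) (ω : Path) : Fin t → Bool := fun i => ω i

theorem cyl_eq_preimage_word (ω : Path) (t : ℕ) : cyl ω t = word t ⁻¹' {word t ω} := by
  ext y
  simp only [PiNat.mem_cylinder_iff, Set.mem_preimage, Set.mem_singleton_iff, word, funext_iff,
    Fin.forall_iff]

theorem surjective_word (t : ℕ) : Function.Surjective (word t) := fun w =>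
  ⟨fun n => if h : n < t then w ⟨n, h⟩ else false, by ext; simp [word]⟩

theorem exists_word_eq_comp_word {s t : ℕ} (h : s ≤ t) :
    ∃ ρ : (Fin t → Bool) → Fin s → Bool, word s = ρ ∘ word t :=
  ⟨fun w i => w (Fin.castLE h i), rfl⟩

theorem isRefining_word (hS : ContainsCylinders S) : IsRefining word where
  measurable t := by
    refine measurable_to_countable' fun w => ?_
    obtain ⟨ω, rfl⟩ := surjective_word t w
    rw [← cyl_eq_preimage_word]
    exact hS ω t
  factor _ _ h := exists_word_eq_comp_word h

theorem cyl_mem_cylAlgebra (ω : Path) (t : ℕ) : cyl ω t ∈ cylAlgebra :=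
  generateSetAlgebra.base _ ⟨ω, t, rfl⟩

theorem univ_mem_cylAlgebra : Set.univ ∈ cylAlgebra :=
  isSetAlgebra_generateSetAlgebra.univ_mem

theorem exists_eq_preimage_word_of_mem_cylAlgebra {A : Set Path} (hA : A ∈ cylAlgebra) :
    ∃ t, ∃ J : Set (Fin t → Bool), A = word t ⁻¹' J := by
  induction hA with
  | base s hs => obtain ⟨ω, t, rfl⟩ := hs; exact ⟨t, _, cyl_eq_preimage_word ω t⟩
  | empty => exact ⟨0, ∅, rfl⟩
  | compl s _ ih => obtain ⟨t, J, rfl⟩ := ih; exact ⟨t, Jᶜ, rfl⟩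
  | union s t _ _ ihs iht =>
    obtain ⟨a, J, rfl⟩ := ihs
    obtain ⟨b, K, rfl⟩ := iht
    obtain ⟨ρ, hρ⟩ := exists_word_eq_comp_word (le_max_left a b)
    obtain ⟨σ, hσ⟩ := exists_word_eq_comp_word (le_max_right a b)
    exact ⟨max a b, ρ ⁻¹' J ∪ σ ⁻¹' K, by rw [hρ, hσ]; rfl⟩

/-- The extension by zero of a set function on the events to all sets of paths, which turns
finitely additive probabilities into charges in the sense of `IsCharge`. -/
def extendZero (P : events S → ℝ) : Set Path → ℝ := Function.extend Subtype.val P 0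

theorem extendZero_apply (P : events S → ℝ) {A : Set Path} (hA : MeasurableSet A) :
    extendZero P A = P ⟨A, hA⟩ :=
  Subtype.val_injective.extend_apply P 0 ⟨A, hA⟩

theorem isCharge_extendZero (hP : P ∈ finAddProb (events S)) : IsCharge (extendZero P) where
  nonneg A hA := extendZero_apply P hA ▸ hP.1 _
  union A B hA hB h := by
    rw [extendZero_apply P hA, extendZero_apply P hB, extendZero_apply P (hA.union hB)]
    exact hP.2.2 _ _ _ h rfl

theorem condProb_eq (hS : ContainsCylinders S) (P : events S → ℝ) (ω : Path) (t : ℕ)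
    (E : events S) :
    condProb hS P ω t E = extendZero P (E ∩ word t ⁻¹' {word t ω}) /
      extendZero P (word t ⁻¹' {word t ω}) := by
  rw [condProb, ← cyl_eq_preimage_word, extendZero_apply P (hS ω t),
    extendZero_apply P (MeasurableSet.inter E.2 (hS ω t))]

theorem setOf_forecastDist_gt (hS : ContainsCylinders S) (hP : P ∈ finAddProb (events S))
    (hQ : Q ∈ finAddProb (events S)) (t : ℕ) (ε : ℝ) :
    {ω | forecastDist hS P Q ω t > ε} =
      word t ⁻¹' discordantCells (word t) (extendZero P) (extendZero Q) ε := by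
  ext ω
  have hbdd : BddAbove (Set.range fun E : events S =>
      |condProb hS P ω t E - condProb hS Q ω t E|) := by
    refine ⟨1, Set.forall_mem_range.2 fun E => ?_⟩
    simp only [condProb_eq]
    exact abs_div_sub_div_le_one (isCharge_extendZero hP) (isCharge_extendZero hQ) E.2
      ((isRefining_word hS).measurable t .of_discrete)
  have : Nonempty (events S) := ⟨⟨∅, MeasurableSet.empty⟩⟩
  change ε < ⨆ E : events S, |condProb hS P ω t E - condProb hS Q ω t E| ↔ _
  rw [lt_ciSup_iff hbdd]
  simp only [condProb_eq]
  exact Subtype.exists.trans (by simp only [exists_prop]; rfl)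

theorem merges_iff_mergesAlong (hS : ContainsCylinders S) (hP : P ∈ finAddProb (events S))
    (hQ : Q ∈ finAddProb (events S)) :
    Merges hS P Q ↔ MergesAlong word (extendZero P) (extendZero Q) := by
  refine forall₂_congr fun ε _ => ?_
  simp only [← setOf_forecastDist_gt hS hP hQ, extendZero_apply Q (forecastDist_event hS P Q _ ε)]

theorem AbsCont.unifAbsCont (hP : P ∈ finAddProb (events S)) (h : AbsCont Q P) :
    UnifAbsCont (extendZero Q) (extendZero P) := by
  intro ε hε
  by_contra! hcon
  choose E hE hPE hQE using fun n : ℕ => hcon (1 / ((n : ℝ) + 1)) Nat.one_div_pos_of_nat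
  simp only [extendZero_apply _ (hE _)] at hPE hQE
  have hlim : Tendsto (fun n => P ⟨E n, hE n⟩) atTop (𝓝 0) :=
    squeeze_zero (fun _ => hP.1 _) (fun n => (hPE n).le) tendsto_one_div_add_atTop_nhds_zero_nat
  exact (ge_of_tendsto' (h _ hlim) hQE).not_gt hε

theorem add_sub_mem_extensions (hS : ContainsCylinders S) (hP : P ∈ finAddProb (events S))
    {μ ν : Set Path → ℝ} (hμ : IsSubcharge μ (extendZero P)) (hν : IsSubcharge ν (extendZero P))
    (hcells : ∀ t i, μ (word t ⁻¹' {i}) = ν (word t ⁻¹' {i})) :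
    (fun B : events S => P B + (μ B - ν B)) ∈ extensions (cylAlgebra_subset_events hS)
      (restrict (cylAlgebra_subset_events hS) P) := by
  have hcyl {A : Set Path} (hA : A ∈ cylAlgebra) : P ⟨A, cylAlgebra_subset_events hS hA⟩ +
      (μ A - ν A) = P ⟨A, cylAlgebra_subset_events hS hA⟩ := by
    obtain ⟨t, J, rfl⟩ := exists_eq_preimage_word_of_mem_cylAlgebra hA
    rw [hμ.preimage_congr hν.toIsCharge ((isRefining_word hS).measurable t) (hcells t), sub_self,
      add_zero]
  refine ⟨⟨fun B => ?_, ?_, ?_⟩, funext fun A => hcyl A.2⟩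
  · have hle := extendZero_apply P B.2 ▸ hν.le B.2
    linarith [hμ.nonneg B.2]
  · rintro ⟨_, hB⟩ rfl
    exact (hcyl univ_mem_cylAlgebra).trans (hP.2.1 _ rfl)
  · rintro B C ⟨_, hD⟩ hBC rfl
    simp only [hP.2.2 B C ⟨_, hD⟩ hBC rfl, hμ.union B.2 C.2 hBC, hν.union B.2 C.2 hBC]
    ring

theorem cellsDetermine_of_mem_extremePoints (hS : ContainsCylinders S)
    (hP : P ∈ finAddProb (events S))
    (h : P ∈ Set.extremePoints ℝ (extensions (cylAlgebra_subset_events hS)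
      (restrict (cylAlgebra_subset_events hS) P))) :
    CellsDetermine word (extendZero P) := by
  intro μ ν hμ hν hcells A hA
  have hmid : P ∈ openSegment ℝ (fun B : events S => P B + (μ B - ν B))
      (fun B : events S => P B + (ν B - μ B)) := by
    refine ⟨1 / 2, 1 / 2, by norm_num, by norm_num, by norm_num, ?_⟩
    funext B
    simp only [Pi.add_apply, Pi.smul_apply, smul_eq_mul]
    ring
  have heq := h.2 (add_sub_mem_extensions hS hP hμ hν hcells)
    (add_sub_mem_extensions hS hP hν hμ fun t i => (hcells t i).symm) hmid
  exact sub_eq_zero.1 (add_eq_left.1 (congrFun heq ⟨A, hA⟩))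

theorem BlackwellDubins.of_mem_extremePoints {hS : ContainsCylinders S}
    (hP : P ∈ finAddProb (events S))
    (h : P ∈ Set.extremePoints ℝ (extensions (cylAlgebra_subset_events hS)
      (restrict (cylAlgebra_subset_events hS) P))) :
    BlackwellDubins hS P := fun _ hQ hQP =>
  (merges_iff_mergesAlong hS hP hQ).2 <|
    (cellsDetermine_of_mem_extremePoints hS hP h).mergesAlong (isRefining_word hS)
      (isCharge_extendZero hP) (isCharge_extendZero hQ) (hQP.unifAbsCont hP)

theorem AbsCont.of_le_mul (hQ : ∀ A, 0 ≤ Q A) {c : ℝ} (h : ∀ A, Q A ≤ c * P A) : AbsCont Q P :=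
  fun _ hE => squeeze_zero (fun _ => hQ _) (fun _ => h _) (by simpa using hE.const_mul c)

theorem BlackwellDubins.merges_of_eq_add {hS : ContainsCylinders S} (h : BlackwellDubins hS P)
    (hQ : Q ∈ finAddProb (events S)) (hR : R ∈ finAddProb (events S)) {a b : ℝ} (ha : 0 < a)
    (hb : 0 < b) (hPQR : P = a • Q + b • R) : Merges hS P Q := by
  refine h Q hQ (AbsCont.of_le_mul hQ.1 (c := a⁻¹) fun A => ?_)
  rw [le_inv_mul_iff₀ ha, hPQR]
  exact le_add_of_nonneg_right (mul_nonneg hb.le (hR.1 A))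

theorem Merges.eq_of_mem_extensions {hS : ContainsCylinders S} (h : Merges hS P Q)
    (hP : P ∈ finAddProb (events S)) (hQ : Q ∈ extensions (cylAlgebra_subset_events hS)
      (restrict (cylAlgebra_subset_events hS) P)) : P = Q := by
  have hcells (t : ℕ) (w : Fin t → Bool) :
      extendZero P (word t ⁻¹' {w}) = extendZero Q (word t ⁻¹' {w}) := by
    obtain ⟨ω, rfl⟩ := surjective_word t w
    rw [← cyl_eq_preimage_word, extendZero_apply P (hS ω t), extendZero_apply Q (hS ω t)]
    exact (congrFun hQ.2 ⟨_, cyl_mem_cylAlgebra ω t⟩).symm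
  funext E
  have heq := ((merges_iff_mergesAlong hS hP hQ.1).1 h).eq_of_cells_eq (isRefining_word hS)
    (isCharge_extendZero hP) (isCharge_extendZero hQ.1) hcells E.2
  rwa [extendZero_apply P E.2, extendZero_apply Q E.2] at heq

end Path

end Merging

end

theorem theorem8 (S : MeasurableSpace Merging.Path) (hS : Merging.ContainsCylinders S)
    (P : Merging.events S → ℝ) (hP : P ∈ Merging.finAddProb (Merging.events S)) :
    List.TFAE [
      P ∈ Set.extremePoints ℝ
        (Merging.extensions (Merging.cylAlgebra_subset_events hS)
          (Merging.restrict (Merging.cylAlgebra_subset_events hS) P)),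
      Merging.BlackwellDubins hS P,
      ∀ Q ∈ Merging.finAddProb (Merging.events S), ∀ R ∈ Merging.finAddProb (Merging.events S),
        ∀ α ∈ Set.Ioo (0 : ℝ) 1, P = α • Q + (1 - α) • R →
          Merging.Merges hS P Q ∧ Merging.Merges hS P R] := by
  tfae_have 1 → 2 := Merging.BlackwellDubins.of_mem_extremePoints hP
  tfae_have 2 → 3 := fun h Q hQ R hR α hα hPQR =>
    ⟨h.merges_of_eq_add hQ hR hα.1 (sub_pos.2 hα.2) hPQR,
      h.merges_of_eq_add hR hQ (sub_pos.2 hα.2) hα.1 (hPQR.trans (add_comm _ _))⟩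
  tfae_have 3 → 1 := by
    refine fun h => ⟨⟨hP, rfl⟩, ?_⟩
    rintro Q hQ R hR ⟨α, β, hα, hβ, hαβ, hPQR⟩
    obtain rfl := eq_sub_of_add_eq' hαβ
    exact ((h Q hQ.1 R hR.1 α ⟨hα, sub_pos.1 hβ⟩ hPQR.symm).1.eq_of_mem_extensions hP hQ).symm
  tfae_finish
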